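/- Let $f:\mathbb{R}\to[0,\infty]$ be proper (i.e. $\operatorname{dom} f:=\{x: f(x)<\infty\}\ne\emptyset$), lower semicontinuous and convex. Suppose that $f$ is essentially smooth, i.e. $\operatorname{int}(\operatorname{dom} f)\neq\emptyset$, $f$ is differentiable on $\operatorname{int}(\operatorname{dom} f)$, and $|f'(x^k)|\to\infty$ whenever $\{x^k\}\subset\operatorname{int}(\operatorname{dom} f)$ converges to a boundary point of $\operatorname{dom} f$. Suppose also that there is a finite set $W\subset\operatorname{int}(\operatorname{dom} f)$ such that $f$ is strongly convex on every compact convex subset of $\operatorname{int}(\operatorname{dom} f)\setminus W$ and $f'$ is locally Lipschitz continuous on every convex subset of $\operatorname{int}(\operatorname{dom} f)\setminus W$. Fix $y\in\operatorname{dom} f$ and let $f_\infty(d):=\sup_{t>0}\frac{f(y+td)-f(y)}{t}$ be the recession function of $f$ (it does not depend on the choice of $y$). Let $f^\pi$ be the closed perspective function of $f$: $f^\pi(x,t)=t f(x/t)$ if $t>0$, $f^\pi(x,0)=f_\infty(x)$, and $f^\pi(x,t)=\infty$ if $t<0$. Let $\mathcal{K}:=\operatorname{epi} f^\pi=\{(x,t,r)\in\mathbb{R}^3: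 r\ge f^\pi(x,t)\}$. For $z\in\mathbb{R}^3$ put $\{z\}^\perp=\{v\in\mathbb{R}^3:\langle v,z\rangle=0\}$, with the standard inner product. For $z,a\in\mathbb{R}^3$, the problem of finding a point of $(\{z\}^\perp+a)\cap\mathcal{K}$ is called nontrivially weakly feasible if $(\{z\}^\perp+a)\cap\mathcal{K}\neq\emptyset$, $(\{z\}^\perp+a)\cap\operatorname{int}\mathcal{K}=\emptyset$ and $(\{z\}^\perp+a)\cap\mathcal{K}\neq\{0\}$. Let $\Upsilon$ be the set of all $z\in\mathbb{R}^3$ for which this problem is nontrivially weakly feasible for some $a\in\mathbb{R}^3$ (for instance $a=0$). Then, for every $s>1$ and for all $z\in\Upsilon$ outside a set of $s$-dimensional Hausdorff measure zero, the pair $\{\mathcal{K},\{z\}^\perp\}$ satisfies a uniform Hölderian error bound with exponent $1/2$: one has $\mathcal{K}\cap\{z\}^\perp\neq\emptyset$, and for every bounded set $B\subset\mathbb{R}^3$ there is a constant $\kappa_B>0$ such that $$\operatorname{d}(x,\mathcal{K}\cap\{z\}^\perp)\le\kappa_B\,\max\{\operatorname{d}(x,\mathcal{K}),\operatorname{d}(x,\{z\}^\perp)\}^{1/2}\qquad\text{for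 all }x\in B,$$ where $\operatorname{d}$ denotes the Euclidean distance from a point to a set. -/

import Mathlib

open Set Filter Topology MeasureTheory

noncomputable section

namespace PerspectiveCone

/-- Three-dimensional Euclidean space. A point `(x, t, r)` has coordinates `p 0`, `p 1`, `p 2`. -/
abbrev E3 : Type := EuclideanSpace ℝ (Fin 3)

/-- The effective domain of an extended-real-valued function. -/
def effDom (f : ℝ → EReal) : Set ℝ := {x | f x < ⊤}

/-- The real-valued representative of `f`; it is only used on (the interior of) `effDom f`,
where `f` is finite. -/
def realValue (f : ℝ → EReal) (x : ℝ) : ℝ := (f x).toReal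

/-- An extended-real-valued function on the line is convex when its epigraph is. -/
def IsConvexFun (f : ℝ → EReal) : Prop := Convex ℝ {p : ℝ × ℝ | f p.1 ≤ (p.2 : EReal)}

/-- Essential smoothness: the domain has nonempty interior, `f` is differentiable there, and
`|f'|` blows up along every sequence of interior points converging to a boundary point. -/
structure EssentiallySmooth (f : ℝ → EReal) : Prop where
  interior_nonempty : (interior (effDom f)).Nonempty
  differentiable : ∀ x ∈ interior (effDom f), DifferentiableAt ℝ (realValue f) x
  blowup : ∀ (u : ℕ → ℝ) (b : ℝ), (∀ k, u k ∈ interior (effDom f)) →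
    b ∈ frontier (effDom f) → Tendsto u atTop (𝓝 b) →
    Tendsto (fun k => |deriv (realValue f) (u k)|) atTop atTop

/-- The standing assumption on the generating function `f : ℝ → [0, ∞]`. -/
structure StandingAssumption (f : ℝ → EReal) : Prop where
  nonneg : ∀ x, 0 ≤ f x
  proper : (effDom f).Nonempty
  closed : LowerSemicontinuous f
  convex : IsConvexFun f
  essentiallySmooth : EssentiallySmooth f
  exceptional : ∃ W : Set ℝ, W.Finite ∧ W ⊆ interior (effDom f) ∧
    (∀ C : Set ℝ, C ⊆ interior (effDom f) \ W → IsCompact C → Convex ℝ C →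
      ∃ m : ℝ, 0 < m ∧ StrongConvexOn C m (realValue f)) ∧
    (∀ D : Set ℝ, D ⊆ interior (effDom f) \ W → Convex ℝ D →
      LocallyLipschitzOn D (deriv (realValue f)))

/-- The recession function of `f`, computed from the base point `y ∈ effDom f`:
`f_∞ (d) = sup_{t > 0} (f (y + t d) - f y) / t`. -/
def recession (f : ℝ → EReal) (y d : ℝ) : EReal :=
  ⨆ t : {t : ℝ // 0 < t}, (f (y + t.1 * d) - f y) / ((t.1 : ℝ) : EReal)

/-- The closed perspective function of `f`; `y ∈ effDom f` is the base point from which the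
recession function is computed. -/
def perspective (f : ℝ → EReal) (y x t : ℝ) : EReal :=
  if 0 < t then (t : EReal) * f (x / t)
  else if t = 0 then recession f y x
  else ⊤

/-- The perspective cone: the epigraph of the perspective function, as a subset of `ℝ³`. -/
def perspectiveCone (f : ℝ → EReal) (y : ℝ) : Set E3 :=
  {p | perspective f y (p 0) (p 1) ≤ ((p 2 : ℝ) : EReal)}

/-- The hyperplane (whole space if `z = 0`) `{z}^⊥`. -/
def perp (z : E3) : Set E3 := {v | inner ℝ v z = 0}

/-- The translate `L + a`. -/
def affineTranslate (L : Set E3) (a : E3) : Set E3 := (fun v => v + a) '' L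

/-- Nontrivial weak feasibility of the problem of finding a point of `A ∩ K`. -/
def NontriviallyWeaklyFeasible (K A : Set E3) : Prop :=
  (A ∩ K).Nonempty ∧ A ∩ interior K = ∅ ∧ A ∩ K ≠ {0}

/-- The pair `{C₁, C₂}` (with a common point) satisfies a uniform Hölderian error bound with
exponent `γ`. -/
def UniformHolderErrorBound (C₁ C₂ : Set E3) (γ : ℝ) : Prop :=
  (C₁ ∩ C₂).Nonempty ∧
  ∀ B : Set E3, Bornology.IsBounded B → ∃ κ : ℝ, 0 < κ ∧ ∀ x ∈ B,
    Metric.infDist x (C₁ ∩ C₂) ≤ κ * (max (Metric.infDist x C₁) (Metric.infDist x C₂)) ^ γ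

/-- The set `Υ` of all `z` such that the feasibility problem for `K` and the affine space
`{z}^⊥ + a` is nontrivially weakly feasible for some `a` (the choice `a = 0` included). -/
def upsilon (K : Set E3) : Set E3 :=
  {z | ∃ a : E3, NontriviallyWeaklyFeasible K (affineTranslate (perp z) a)}

end PerspectiveCone

end

/-! Weak feasibility forces `{z}^⊥ + a` to support `K` through the origin: up to sign, `z` lies in
the dual cone and is orthogonal to some nonzero `v ∈ K` (`exists_face_of_mem_upsilon`). By
`uniformHolder_of_face_bound` it then suffices to bound the distance from `k ∈ K` to the face `K ∩
{z}^⊥` by a multiple of `√⟨k, z⟩`, for `k` bounded.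

If `z 2 > 0` and `v 1 > 0`, the affine function encoded by `z` touches the graph of `f` over `u = v
0 / v 1`. Essential smoothness puts `u` in the interior of the domain. When `u ∉ W`, strong
convexity gives quadratic growth around `u`; homogenized, this yields the square-root bound
(`face_bound_of_quadratic_growth`).

Otherwise the face contains a nonzero vector of zero scale. If `z` stays in the dual cone when its
scale coordinate is slightly decreased, then `⟨k, z⟩ ≥ δ * k 1`, and the bound is even Lipschitzian
(`face_bound_of_recession`).

What remains lies in finitely many lines: the scale axis, at most four lines meeting the lower
boundary of the dual cone, and one line of tangents for each point of `W`. Lines are null for the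
`s`-dimensional measure when `s > 1`. -/

namespace PerspectiveCone

/-! ### Convex analysis of `f` on the line -/

section Scalar

variable {f : ℝ → EReal}

theorem le_coe_iff (hf : StandingAssumption f) {x c : ℝ} :
    f x ≤ (c : EReal) ↔ x ∈ effDom f ∧ realValue f x ≤ c := by
  have h0 : f x ≠ ⊥ := fun h => by simpa [h] using hf.nonneg x
  constructor
  · intro h
    have hx : f x < ⊤ := h.trans_lt (EReal.coe_lt_top c)
    refine ⟨hx, ?_⟩
    have : ((realValue f x : ℝ) : EReal) ≤ c := by
      rw [realValue, EReal.coe_toReal hx.ne h0]; exact h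
    exact_mod_cast this
  · rintro ⟨hx, h⟩
    rw [← EReal.coe_toReal (ne_of_lt hx) h0]
    exact_mod_cast h

theorem coe_realValue (hf : StandingAssumption f) {x : ℝ} (hx : x ∈ effDom f) :
    ((realValue f x : ℝ) : EReal) = f x :=
  EReal.coe_toReal (ne_of_lt hx) (fun h => by simpa [h] using hf.nonneg x)

theorem realValue_nonneg (hf : StandingAssumption f) (x : ℝ) : 0 ≤ realValue f x :=
  EReal.toReal_nonneg (hf.nonneg x)

theorem convexOn_realValue (hf : StandingAssumption f) :
    ConvexOn ℝ (effDom f) (realValue f) := by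
  have key : ∀ ⦃x⦄, x ∈ effDom f → ∀ ⦃w⦄, w ∈ effDom f → ∀ ⦃a b : ℝ⦄, 0 ≤ a → 0 ≤ b → a + b = 1 →
      a • x + b • w ∈ effDom f ∧
        realValue f (a • x + b • w) ≤ a • realValue f x + b • realValue f w := by
    intro x hx w hw a b ha hb hab
    have h := hf.convex (x := (x, realValue f x)) (by simp [coe_realValue hf hx])
      (y := (w, realValue f w)) (by simp [coe_realValue hf hw]) ha hb hab
    exact (le_coe_iff hf).1 h
  exact ⟨fun x hx w hw a b ha hb hab => (key hx hw ha hb hab).1,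
    fun x hx w hw a b ha hb hab => (key hx hw ha hb hab).2⟩

theorem convex_effDom (hf : StandingAssumption f) : Convex ℝ (effDom f) :=
  (convexOn_realValue hf).1

/-- The graph of a convex function lies above its tangent lines. -/
theorem tangent_le (hf : StandingAssumption f) {p w : ℝ} (hp : p ∈ interior (effDom f))
    (hw : w ∈ effDom f) :
    realValue f p + deriv (realValue f) p * (w - p) ≤ realValue f w := by
  have hd := (hf.essentiallySmooth.differentiable p hp).hasDerivAt
  have hc := convexOn_realValue hf
  rcases lt_trichotomy p w with h | h | h
  · have := hc.le_slope_of_hasDerivAt (interior_subset hp) hw h hd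
    rw [slope_def_field, le_div_iff₀ (by linarith)] at this
    linarith
  · simp [h]
  · have := hc.slope_le_of_hasDerivAt hw (interior_subset hp) h hd
    rw [slope_def_field, div_le_iff₀ (by linarith)] at this
    linarith

/-- An affine minorant touching the graph over the interior is the tangent line. -/
theorem slope_eq_deriv (hf : StandingAssumption f) {u σ : ℝ} (hu : u ∈ interior (effDom f))
    (h : ∀ w ∈ effDom f, realValue f u + σ * (w - u) ≤ realValue f w) :
    σ = deriv (realValue f) u := by
  have hd := (hf.essentiallySmooth.differentiable u hu).hasDerivAt
  have hg : HasDerivAt (fun w => realValue f w - σ * w) (deriv (realValue f) u - σ * 1) u :=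
    hd.sub ((hasDerivAt_id u).const_mul σ)
  have hmin : IsLocalMin (fun w => realValue f w - σ * w) u := by
    filter_upwards [mem_interior_iff_mem_nhds.1 hu] with w hw
    linarith [h w hw]
  linarith [hmin.hasDerivAt_eq_zero hg]

/-- Essential smoothness excludes affine minorants touching the graph over a boundary point. -/
theorem mem_interior_of_touching (hf : StandingAssumption f) {u σ : ℝ} (hu : u ∈ effDom f)
    (h : ∀ w ∈ effDom f, realValue f u + σ * (w - u) ≤ realValue f w) :
    u ∈ interior (effDom f) := by
  by_contra hni
  obtain ⟨p, hp⟩ := hf.essentiallySmooth.interior_nonempty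
  have hfr : u ∈ frontier (effDom f) := ⟨subset_closure hu, hni⟩
  have hpu : p ≠ u := fun e => hni (e ▸ hp)
  have habs : 0 < |p - u| := abs_pos.2 (sub_ne_zero.2 hpu)
  let a : ℕ → ℝ := fun k => 1 / ((k : ℝ) + 1)
  have ha0 : Tendsto a atTop (𝓝 0) := tendsto_one_div_add_atTop_nhds_zero_nat
  -- Approach `u` along the segment towards `p`. Halving keeps the weight of `p` at most `1 / 2`,
  -- whence the factor `2` in the slope bound below.
  let v : ℕ → ℝ := fun k => u + (a k / 2) * (p - u)
  have hv : ∀ k, v k ∈ interior (effDom f) := by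
    intro k
    have h1 : 0 < a k := by positivity
    have h2 : a k ≤ 1 := by
      rw [div_le_one (by positivity)]; linarith [Nat.cast_nonneg (α := ℝ) k]
    apply (convex_effDom hf).openSegment_self_interior_subset_interior hu hp
    exact ⟨1 - a k / 2, a k / 2, by linarith, by linarith, by ring, by
      simp only [smul_eq_mul, v]; ring⟩
  have hvl : Tendsto v atTop (𝓝 u) := by
    have : Tendsto v atTop (𝓝 (u + (0 / 2) * (p - u))) :=
      tendsto_const_nhds.add ((ha0.div_const 2).mul_const _)
    simpa using this
  have hblow := hf.essentiallySmooth.blowup v u hv hfr hvl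
  set G := realValue f p - realValue f u - σ * (p - u)
  have hbound : ∀ k, |deriv (realValue f) (v k)| ≤ |σ| + 2 * G / |p - u| := by
    intro k
    have h1 : 0 < a k := by positivity
    have h2 : a k ≤ 1 := by
      rw [div_le_one (by positivity)]; linarith [Nat.cast_nonneg (α := ℝ) k]
    set D := deriv (realValue f) (v k)
    have t1 := tangent_le hf (hv k) hu
    have t2 := tangent_le hf (hv k) (interior_subset hp)
    have t3 := h (v k) (interior_subset (hv k))
    have e1 : u - v k = - (a k / 2) * (p - u) := by simp only [v]; ring
    have e2 : p - v k = (1 - a k / 2) * (p - u) := by simp only [v]; ring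
    have e3 : v k - u = (a k / 2) * (p - u) := by simp only [v]; ring
    rw [e1] at t1; rw [e2] at t2; rw [e3] at t3
    -- The tangent at `v k`, compared with the given minorant, bounds `D` from one side when
    -- evaluated at `u` and from the other when evaluated at `p`.
    have n0 : 0 ≤ (D - σ) * (p - u) := by
      have : 0 ≤ (a k / 2) * ((D - σ) * (p - u)) := by nlinarith
      exact nonneg_of_mul_nonneg_right this (by linarith)
    have n1 : (1 - a k / 2) * ((D - σ) * (p - u)) ≤ G := by simp only [G]; nlinarith
    have n2 : (D - σ) * (p - u) ≤ 2 * G := by nlinarith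
    have n3 : |D - σ| ≤ 2 * G / |p - u| := by
      rw [le_div_iff₀ habs, ← abs_mul, abs_of_nonneg n0]; exact n2
    have := abs_add_le (D - σ) σ
    rw [sub_add_cancel] at this
    linarith
  obtain ⟨k, hk⟩ := (hblow.eventually_gt_atTop (|σ| + 2 * G / |p - u|)).exists
  exact absurd (hbound k) (not_le.2 hk)

theorem exists_Icc_strongConvexOn {W : Set ℝ} (hW : W.Finite)
    (hsc : ∀ C : Set ℝ, C ⊆ interior (effDom f) \ W → IsCompact C → Convex ℝ C →
      ∃ m : ℝ, 0 < m ∧ StrongConvexOn C m (realValue f))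
    {u : ℝ} (hu : u ∈ interior (effDom f)) (huW : u ∉ W) :
    ∃ ρ m : ℝ, 0 < ρ ∧ 0 < m ∧ Icc (u - ρ) (u + ρ) ⊆ interior (effDom f) ∧
      StrongConvexOn (Icc (u - ρ) (u + ρ)) m (realValue f) := by
  have ho : IsOpen (interior (effDom f) \ W) := isOpen_interior.sdiff hW.isClosed
  obtain ⟨ρ, hρ, hs⟩ := Metric.nhds_basis_closedBall.mem_iff.1 (ho.mem_nhds ⟨hu, huW⟩)
  rw [Real.closedBall_eq_Icc] at hs
  obtain ⟨m, hm, h⟩ := hsc _ hs isCompact_Icc (convex_Icc _ _)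
  exact ⟨ρ, m, hρ, hm, hs.trans sdiff_subset, h⟩

/-- If every slope vanished, tangent lines would give equal values at the ends of a short interval,
not above the value at its midpoint, against strong convexity. This is what makes the cone pointed
(`exists_dual_pos`). -/
theorem exists_deriv_ne_zero (hf : StandingAssumption f) :
    ∃ p ∈ interior (effDom f), deriv (realValue f) p ≠ 0 := by
  obtain ⟨W, hW, -, hsc, -⟩ := hf.exceptional
  have hinf : (interior (effDom f)).Infinite :=
    by
    obtain ⟨p, hp⟩ := hf.essentiallySmooth.interior_nonempty
    exact infinite_of_mem_nhds p (isOpen_interior.mem_nhds hp)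
  obtain ⟨u, hu, huW⟩ := (hinf.sdiff hW).nonempty
  obtain ⟨ρ, m, hρ, hm, hs, -, h⟩ := exists_Icc_strongConvexOn hW hsc hu huW
  by_contra! hcon
  have hl : u - ρ ∈ Icc (u - ρ) (u + ρ) := by constructor <;> linarith
  have hr : u + ρ ∈ Icc (u - ρ) (u + ρ) := by constructor <;> linarith
  have h1 := tangent_le hf (hs hl) (interior_subset hu)
  have h2 := tangent_le hf (hs hl) (interior_subset (hs hr))
  have h3 := tangent_le hf (hs hr) (interior_subset (hs hl))
  rw [hcon _ (hs hl)] at h1 h2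
  rw [hcon _ (hs hr)] at h3
  have h4 := h hl hr (a := 1 / 2) (b := 1 / 2) (by norm_num) (by norm_num) (by norm_num)
  have e : (1 / 2 : ℝ) • (u - ρ) + (1 / 2 : ℝ) • (u + ρ) = u := by simp only [smul_eq_mul]; ring
  rw [e] at h4
  have e2 : ‖u - ρ - (u + ρ)‖ ^ 2 = 4 * ρ ^ 2 := by
    rw [Real.norm_eq_abs, sq_abs]; ring
  simp only [e2, smul_eq_mul] at h4
  have : 0 < m * ρ ^ 2 := by positivity
  linarith

/-- Where strong convexity is available, a nonnegative affine perturbation of `f` vanishing at `u`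
grows quadratically near `u` and linearly far away, stated through its affine minorants. -/
theorem exists_quadratic_growth (hf : StandingAssumption f) {W : Set ℝ} (hW : W.Finite)
    (hsc : ∀ C : Set ℝ, C ⊆ interior (effDom f) \ W → IsCompact C → Convex ℝ C →
      ∃ m : ℝ, 0 < m ∧ StrongConvexOn C m (realValue f))
    {u : ℝ} (hu : u ∈ interior (effDom f)) (huW : u ∉ W) {a b c : ℝ} (hc : 0 < c)
    (hg : ∀ w ∈ effDom f, 0 ≤ a * w + b + c * realValue f w)
    (hgu : a * u + b + c * realValue f u = 0) :
    ∃ m : ℝ, 0 < m ∧ ∀ w ∈ effDom f, ∀ l : ℝ, |l| ≤ 1 / 2 →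
      m * (2 * l * (w - u) - l ^ 2) ≤ a * w + b + c * realValue f w := by
  obtain ⟨ρ, m, hρ, hm, hs, -, h⟩ := exists_Icc_strongConvexOn hW hsc hu huW
  have huI : u ∈ Icc (u - ρ) (u + ρ) := by constructor <;> linarith
  -- Strong convexity at the midpoint of `u` and `w`, where the perturbed function is still
  -- nonnegative.
  have hnear : ∀ w ∈ Icc (u - ρ) (u + ρ), c * m / 4 * (w - u) ^ 2 ≤
      a * w + b + c * realValue f w := by
    intro w hw
    have h4 := h huI hw (a := 1 / 2) (b := 1 / 2) (by norm_num) (by norm_num) (by norm_num)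
    have hmid := hg _ (convex_effDom hf (interior_subset hu) (interior_subset (hs hw))
      (a := 1 / 2) (b := 1 / 2) (by norm_num) (by norm_num) (by norm_num))
    simp only [Real.norm_eq_abs, sq_abs, smul_eq_mul] at h4 hmid
    have h5 := mul_le_mul_of_nonneg_left h4 hc.le
    nlinarith
  -- Convexity along the segment from `u` to `w` propagates the bound at `q`, the point at distance
  -- `ρ` from `u`.
  have hfar : ∀ w ∈ effDom f, ρ < |w - u| → c * m * ρ / 4 * |w - u| ≤
      a * w + b + c * realValue f w := by
    intro w hw hlt
    set d := |w - u|
    have hd : 0 < d := hρ.trans hlt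
    set q := u + (ρ / d) * (w - u)
    have hqu : (q - u) ^ 2 = ρ ^ 2 := by
      have : (w - u) ^ 2 = d ^ 2 := (sq_abs _).symm
      simp only [q, add_sub_cancel_left, mul_pow, this]
      field_simp
    have hq : q ∈ Icc (u - ρ) (u + ρ) := by
      have := abs_le_of_sq_le_sq' hqu.le hρ.le
      constructor <;> linarith [this.1, this.2]
    have hθ : ρ / d ≤ 1 := (div_le_one hd).2 hlt.le
    obtain ⟨-, hconv⟩ := convexOn_realValue hf
    replace hconv := hconv (interior_subset hu) hw
      (a := 1 - ρ / d) (b := ρ / d) (by linarith) (by positivity) (by ring)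
    have e : (1 - ρ / d) • u + (ρ / d) • w = q := by simp only [smul_eq_mul, q]; ring
    rw [e] at hconv
    simp only [smul_eq_mul] at hconv
    have hn := hnear q hq
    rw [hqu] at hn
    have h5 := mul_le_mul_of_nonneg_left hconv hc.le
    have h6 : c * m / 4 * ρ ^ 2 ≤ (ρ / d) * (a * w + b + c * realValue f w) := by
      have : a * q + b = (1 - ρ / d) * (a * u + b) + (ρ / d) * (a * w + b) := by
        simp only [q]; ring
      nlinarith
    rw [div_mul_eq_mul_div ρ, le_div_iff₀ hd] at h6
    have h7 : ρ * (c * m * ρ / 4 * d) ≤ ρ * (a * w + b + c * realValue f w) := by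
      linarith
    exact le_of_mul_le_mul_left h7 hρ
  -- With `d = w - u`, the affine function `2 * l * d - l ^ 2` is below `d ^ 2` always, and below
  -- `|d|` once `|l| ≤ 1 / 2`.
  refine ⟨min (c * m / 4) (c * m * ρ / 4), by positivity, fun w hw l hl => ?_⟩
  set M := min (c * m / 4) (c * m * ρ / 4)
  have hM : 0 < M := by positivity
  obtain ⟨l1, l2⟩ := abs_le.1 hl
  by_cases hd : |w - u| ≤ ρ
  · have hwI : w ∈ Icc (u - ρ) (u + ρ) := by
      have := abs_le.1 hd
      constructor <;> linarith [this.1, this.2]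
    refine le_trans ?_ (hnear w hwI)
    refine le_trans ?_ (mul_le_mul_of_nonneg_right (min_le_left _ (c * m * ρ / 4)) (sq_nonneg _))
    exact mul_le_mul_of_nonneg_left (by nlinarith [sq_nonneg (w - u - l)]) hM.le
  · refine le_trans ?_ (hfar w hw (not_le.1 hd))
    refine le_trans ?_ (mul_le_mul_of_nonneg_right (min_le_right (c * m / 4) _) (abs_nonneg _))
    refine mul_le_mul_of_nonneg_left ?_ hM.le
    have : 2 * l * (w - u) ≤ |w - u| := by
      calc 2 * l * (w - u) ≤ |2 * l * (w - u)| := le_abs_self _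
        _ = (2 * |l|) * |w - u| := by rw [abs_mul, abs_mul]; norm_num
        _ ≤ 1 * |w - u| := mul_le_mul_of_nonneg_right (by linarith) (abs_nonneg _)
        _ = _ := one_mul _
    nlinarith [sq_nonneg l]

end Scalar

/-! ### The perspective cone and its supporting hyperplanes -/

section Cone

variable {f : ℝ → EReal} {y : ℝ}

theorem inner_eq_coords (v z : E3) : inner ℝ v z = v 0 * z 0 + v 1 * z 1 + v 2 * z 2 := by
  simp [PiLp.inner_apply, Fin.sum_univ_three, mul_comm]

theorem mem_cone_of_pos {p : E3} (hp : 0 < p 1) :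
    p ∈ perspectiveCone f y ↔ f (p 0 / p 1) ≤ ((p 2 / p 1 : ℝ) : EReal) := by
  have h0 : (0 : EReal) < ((p 1 : ℝ) : EReal) := by exact_mod_cast hp
  simp only [perspectiveCone, perspective, mem_ofPred_eq, if_pos hp]
  rw [EReal.coe_div, EReal.le_div_iff_mul_le h0 (EReal.coe_ne_top _), mul_comm]

theorem mem_cone_of_zero (hf : StandingAssumption f) (hy : y ∈ effDom f) {p : E3} (hp : p 1 = 0) :
    p ∈ perspectiveCone f y ↔
      ∀ t : ℝ, 0 < t → f (y + t * p 0) ≤ ((realValue f y + t * p 2 : ℝ) : EReal) := by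
  simp only [perspectiveCone, perspective, mem_ofPred_eq, hp, lt_irrefl, if_false, if_true,
    recession, iSup_le_iff, Subtype.forall]
  refine forall₂_congr fun t ht => ?_
  have h0 : (0 : EReal) < ((t : ℝ) : EReal) := by exact_mod_cast ht
  rw [EReal.div_le_iff_le_mul h0 (EReal.coe_ne_top _), ← coe_realValue hf hy,
    EReal.sub_le_iff_le_add (Or.inl (EReal.coe_ne_bot _)) (Or.inl (EReal.coe_ne_top _)),
    ← EReal.coe_mul, ← EReal.coe_add, add_comm (t * p 2)]

theorem nonneg_of_mem_cone {p : E3} (hp : p ∈ perspectiveCone f y) : 0 ≤ p 1 := by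
  by_contra! h
  simp [perspectiveCone, perspective, not_lt.2 h.le, h.ne] at hp

/-- Affine minorants of `f` give valid homogeneous inequalities on the perspective cone. -/
theorem minorant_le (hf : StandingAssumption f) (hy : y ∈ effDom f) {a b : ℝ}
    (h : ∀ w ∈ effDom f, a * w + b ≤ realValue f w) {p : E3} (hp : p ∈ perspectiveCone f y) :
    a * p 0 + b * p 1 ≤ p 2 := by
  rcases (nonneg_of_mem_cone hp).eq_or_lt with h1 | h1
  · rw [mem_cone_of_zero hf hy h1.symm] at hp
    rw [← h1]
    by_contra! hlt
    have key : ∀ t : ℝ, 0 < t → t * (a * p 0 - p 2) ≤ realValue f y - a * y - b := by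
      intro t ht
      have := (le_coe_iff hf).1 (hp t ht)
      linarith [h _ this.1, this.2]
    have hpos : 0 < a * p 0 - p 2 := by linarith
    have hnn := h y hy
    have := key ((realValue f y - a * y - b + 1) / (a * p 0 - p 2)) (by
      apply div_pos _ hpos; linarith)
    rw [div_mul_cancel₀ _ hpos.ne'] at this
    linarith
  · rw [mem_cone_of_pos h1] at hp
    have h2 := (le_coe_iff hf).1 hp
    have h3 := mul_le_mul_of_nonneg_right ((h _ h2.1).trans h2.2) h1.le
    rw [div_mul_cancel₀ _ h1.ne', add_mul, mul_assoc, div_mul_cancel₀ _ h1.ne'] at h3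
    exact h3

theorem height_nonneg (hf : StandingAssumption f) (hy : y ∈ effDom f) {p : E3}
    (hp : p ∈ perspectiveCone f y) : 0 ≤ p 2 := by
  have := minorant_le hf hy (a := 0) (b := 0) (fun w _ => by simpa using realValue_nonneg hf w) hp
  simpa using this

theorem graph_mem_cone (hf : StandingAssumption f) {w : ℝ} (hw : w ∈ effDom f) :
    (!₂[w, 1, realValue f w] : E3) ∈ perspectiveCone f y := by
  rw [mem_cone_of_pos (by simp)]
  simp [coe_realValue hf hw]

theorem axis_mem_cone (hf : StandingAssumption f) (hy : y ∈ effDom f) :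
    (!₂[0, 0, 1] : E3) ∈ perspectiveCone f y := by
  rw [mem_cone_of_zero hf hy (by simp)]
  intro t ht
  rw [le_coe_iff hf]
  simp [hy, ht.le]

theorem zero_mem_cone (hf : StandingAssumption f) (hy : y ∈ effDom f) :
    (0 : E3) ∈ perspectiveCone f y := by
  rw [mem_cone_of_zero hf hy (by simp)]
  intro t ht
  rw [le_coe_iff hf]
  simp [hy]

theorem smul_mem_cone (hf : StandingAssumption f) (hy : y ∈ effDom f) {p : E3}
    (hp : p ∈ perspectiveCone f y) {a : ℝ} (ha : 0 ≤ a) : a • p ∈ perspectiveCone f y := by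
  rcases ha.eq_or_lt with rfl | ha
  · simpa using zero_mem_cone hf hy
  rcases (nonneg_of_mem_cone hp).eq_or_lt with h1 | h1
  · rw [mem_cone_of_zero hf hy h1.symm] at hp
    rw [mem_cone_of_zero hf hy (by simp [← h1])]
    intro t ht
    have := hp (t * a) (by positivity)
    simpa [mul_assoc] using this
  · rw [mem_cone_of_pos h1] at hp
    rw [mem_cone_of_pos (by simpa using mul_pos ha h1)]
    simpa [mul_div_mul_left _ _ ha.ne'] using hp

/-- The perspective cone without its points of zero scale. -/
def openPart (f : ℝ → EReal) : Set E3 :=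
  {p | 0 < p 1 ∧ p 0 / p 1 ∈ effDom f ∧ realValue f (p 0 / p 1) ≤ p 2 / p 1}

theorem openPart_subset (hf : StandingAssumption f) : openPart f ⊆ perspectiveCone f y :=
  fun _ hp => (mem_cone_of_pos hp.1).2 ((le_coe_iff hf).2 hp.2)

/-- The ratio of a combination is the combination of the ratios with weights proportional to the
scales, `a * p 1 / T` and `b * q 1 / T`. -/
theorem convex_openPart (hf : StandingAssumption f) : Convex ℝ (openPart f) := by
  rintro p ⟨hp1, hp2, hp3⟩ q ⟨hq1, hq2, hq3⟩ a b ha hb hab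
  have hT : 0 < a * p 1 + b * q 1 := by
    rcases ha.eq_or_lt with rfl | ha
    · have : b = 1 := by linarith
      simpa [this] using hq1
    · have := mul_pos ha hp1
      have := mul_nonneg hb hq1.le
      linarith
  set T := a * p 1 + b * q 1
  have hs : a * p 1 / T + b * q 1 / T = 1 := by rw [← add_div, div_self hT.ne']
  have hA : 0 ≤ a * p 1 / T := by positivity
  have hB : 0 ≤ b * q 1 / T := by positivity
  have hmem := convex_effDom hf hp2 hq2 hA hB hs
  obtain ⟨-, hconv⟩ := convexOn_realValue hf
  have hle := hconv hp2 hq2 hA hB hs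
  have e : (a * p 1 / T) • (p 0 / p 1) + (b * q 1 / T) • (q 0 / q 1) =
      (a * p 0 + b * q 0) / T := by
    simp only [smul_eq_mul]; field_simp
  rw [e] at hmem hle
  refine ⟨by simpa using hT, by simpa using hmem, ?_⟩
  have h3 : (a * p 1 / T) • realValue f (p 0 / p 1) + (b * q 1 / T) • realValue f (q 0 / q 1) ≤
      (a * p 1 / T) * (p 2 / p 1) + (b * q 1 / T) * (q 2 / q 1) :=
    add_le_add (mul_le_mul_of_nonneg_left hp3 hA) (mul_le_mul_of_nonneg_left hq3 hB)
  have e2 : (a * p 1 / T) * (p 2 / p 1) + (b * q 1 / T) * (q 2 / q 1) =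
      (a * p 2 + b * q 2) / T := by field_simp
  rw [e2] at h3
  simpa using hle.trans h3

theorem interior_openPart_nonempty (hf : StandingAssumption f) :
    (interior (openPart f)).Nonempty := by
  obtain ⟨p, hp⟩ := hf.essentiallySmooth.interior_nonempty
  refine ⟨!₂[p, 1, realValue f p + 1], mem_interior_iff_mem_nhds.2 ?_⟩
  set P : E3 := !₂[p, 1, realValue f p + 1]
  have hP : P 0 / P 1 = p := by simp [P]
  have c0 : ContinuousAt (fun q : E3 => q 0 / q 1) P :=
    ContinuousAt.div (by fun_prop) (by fun_prop) (by simp [P])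
  have c1 : ContinuousAt (fun q : E3 => q 2 / q 1) P :=
    ContinuousAt.div (by fun_prop) (by fun_prop) (by simp [P])
  have cf : ContinuousAt (fun q : E3 => realValue f (q 0 / q 1)) P := by
    have h := (hf.essentiallySmooth.differentiable p hp).continuousAt
    rw [← hP] at h
    exact ContinuousAt.comp (f := fun q : E3 => q 0 / q 1) h c0
  have c2 : ContinuousAt (fun q : E3 => q 1) P := by fun_prop
  have e1 : ∀ᶠ q in 𝓝 P, 0 < q 1 := c2.eventually_const_lt (by simp [P])
  have e2 : ∀ᶠ q in 𝓝 P, q 0 / q 1 ∈ effDom f :=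
    c0 (by simpa only [hP] using mem_interior_iff_mem_nhds.1 hp)
  have e3 : ∀ᶠ q in 𝓝 P, realValue f (q 0 / q 1) < q 2 / q 1 :=
    cf.eventually_lt c1 (by simp [P])
  filter_upwards [e1, e2, e3] with q h1 h2 h3
  exact ⟨h1, h2, h3.le⟩

/-- Adding a small multiple of the graph point over `y` to a recession vector moves it into the open
part. Separation can thus be done on the open part alone. -/
theorem cone_subset_closure_openPart (hf : StandingAssumption f) (hy : y ∈ effDom f) :
    perspectiveCone f y ⊆ closure (openPart f) := by
  intro p hp
  rcases (nonneg_of_mem_cone hp).eq_or_lt with h1 | h1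
  · rw [mem_cone_of_zero hf hy h1.symm] at hp
    let u : ℕ → E3 := fun n => p + (1 / ((n : ℝ) + 1)) • !₂[y, 1, realValue f y]
    have hu : Tendsto u atTop (𝓝 p) := by
      have := (tendsto_one_div_add_atTop_nhds_zero_nat (𝕜 := ℝ)).smul_const
        (!₂[y, 1, realValue f y] : E3)
      simpa [u] using this.const_add p
    refine mem_closure_of_tendsto hu (Eventually.of_forall fun n => ?_)
    have hn : (0 : ℝ) < (n : ℝ) + 1 := by positivity
    have := (le_coe_iff hf).1 (hp _ hn)
    have e0 : (u n) 0 / (u n) 1 = y + ((n : ℝ) + 1) * p 0 := by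
      simp [u, ← h1]; field_simp; ring
    have e2 : (u n) 2 / (u n) 1 = realValue f y + ((n : ℝ) + 1) * p 2 := by
      simp [u, ← h1]; field_simp; ring
    refine ⟨by simp [u, ← h1]; positivity, ?_, ?_⟩
    · rw [e0]; exact this.1
    · rw [e0, e2]; exact this.2
  · exact subset_closure ⟨h1, (le_coe_iff hf).1 ((mem_cone_of_pos h1).1 hp)⟩

/-- The dual cone. -/
def dualCone (K : Set E3) : Set E3 := {z | ∀ k ∈ K, 0 ≤ inner ℝ k z}

theorem perp_neg (z : E3) : perp (-z) = perp z := by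
  ext v; simp [perp]

/-- Nontrivial weak feasibility forces the hyperplane to be a supporting one through the origin,
exposing a nonzero face. -/
theorem exists_face_of_mem_upsilon (hf : StandingAssumption f) (hy : y ∈ effDom f) {z : E3}
    (hz : z ∈ upsilon (perspectiveCone f y)) :
    (z ∈ dualCone (perspectiveCone f y) ∨ -z ∈ dualCone (perspectiveCone f y)) ∧
      ∃ v ∈ perspectiveCone f y, v ≠ 0 ∧ inner ℝ v z = 0 := by
  obtain ⟨a, ⟨v, hvA, hvK⟩, hdisj, hne⟩ := hz
  have hA : ∀ q : E3, q ∈ affineTranslate (perp z) a ↔ inner ℝ q z = inner ℝ a z := by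
    intro q
    constructor
    · rintro ⟨w, hw, rfl⟩
      have : inner ℝ w z = 0 := hw
      simp [inner_add_left, this]
    · intro h
      exact ⟨q - a, by simp [perp, inner_sub_left, h], by simp⟩
  set I := interior (openPart f)
  have hI : Convex ℝ I := (convex_openPart hf).interior
  have hKI : perspectiveCone f y ⊆ closure I := by
    rw [(convex_openPart hf).closure_interior_eq_closure_of_nonempty_interior
      (interior_openPart_nonempty hf)]
    exact cone_subset_closure_openPart hf hy
  have hIne : ∀ q ∈ I, (inner ℝ q z : ℝ) ≠ inner ℝ a z := by
    intro q hq h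
    have : q ∈ affineTranslate (perp z) a ∩ interior (perspectiveCone f y) :=
      ⟨(hA q).2 h, interior_mono (openPart_subset hf) hq⟩
    rw [hdisj] at this
    exact this
  have hcont : Continuous fun q : E3 => (inner ℝ q z : ℝ) := by fun_prop
  have hv : (inner ℝ v z : ℝ) = inner ℝ a z := (hA v).1 hvA
  have hside : (∀ k ∈ perspectiveCone f y, (inner ℝ a z : ℝ) ≤ inner ℝ k z) ∨
      (∀ k ∈ perspectiveCone f y, (inner ℝ k z : ℝ) ≤ inner ℝ a z) := by
    -- A connected set avoiding a level of a continuous function stays on one side of it.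
    have hIside : (∀ q ∈ I, (inner ℝ a z : ℝ) ≤ inner ℝ q z) ∨
        (∀ q ∈ I, (inner ℝ q z : ℝ) ≤ inner ℝ a z) := by
      by_contra! hcon
      obtain ⟨⟨q, hq, hq'⟩, ⟨q2, hq2, hq2'⟩⟩ := hcon
      obtain ⟨q3, hq3, h3⟩ := hI.isPreconnected.intermediate_value hq hq2 hcont.continuousOn
        ⟨hq'.le, hq2'.le⟩
      exact hIne q3 hq3 h3
    refine hIside.imp (fun h k hk => ?_) (fun h k hk => ?_)
    · exact closure_minimal h (isClosed_le continuous_const hcont) (hKI hk)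
    · exact closure_minimal h (isClosed_le hcont continuous_const) (hKI hk)
  have h2 := smul_mem_cone hf hy hvK (a := 2) (by norm_num)
  have h0 := zero_mem_cone hf hy
  -- The points `0`, `v` and `2 • v` of the cone lie on one side of the level, and `v` lies on it.
  have hc : (inner ℝ a z : ℝ) = 0 := by
    rcases hside with h | h
    · have g2 := h _ h2
      have g0 := h _ h0
      rw [inner_smul_left, hv] at g2
      simp at g2 g0
      linarith
    · have g2 := h _ h2
      have g0 := h _ h0
      rw [inner_smul_left, hv] at g2
      simp at g2 g0
      linarith
  rw [hc] at hside hA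
  refine ⟨hside.imp (fun h k hk => h k hk) (fun h k hk => ?_), ?_⟩
  · rw [inner_neg_right]; linarith [h k hk]
  · by_contra! hcon
    apply hne
    ext q
    rw [mem_inter_iff, hA, mem_singleton_iff]
    constructor
    · rintro ⟨h, hq⟩
      by_contra hq0
      exact hcon q hq hq0 h
    · rintro rfl
      exact ⟨by simp, h0⟩

end Cone

/-! ### From face bounds to Hölderian error bounds -/

section ErrorBound

/-- A square-root bound for the distance to the exposed face, valid on bounded parts of the cone,
yields the uniform Hölderian error bound with exponent `1 / 2`. -/
theorem uniformHolder_of_face_bound {K : Set E3} {z : E3} (h0 : (0 : E3) ∈ K)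
    (hz : z ∈ dualCone K)
    (H : ∀ R : ℝ, ∃ C : ℝ, 0 ≤ C ∧ ∀ k ∈ K, ‖k‖ ≤ R →
      Metric.infDist k (K ∩ perp z) ≤ C * √(inner ℝ k z)) :
    UniformHolderErrorBound K (perp z) (1 / 2) := by
  have h0p : (0 : E3) ∈ perp z := by simp [perp]
  refine ⟨⟨0, h0, h0p⟩, fun B hB => ?_⟩
  obtain ⟨R, hR⟩ := hB.exists_norm_le
  set R' := max R 0
  have hR' : 0 ≤ R' := le_max_right _ _
  obtain ⟨C, hC, hCK⟩ := H (2 * R' + 1)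
  refine ⟨√R' + C * √(2 * ‖z‖) + 1, by positivity, fun x hx => ?_⟩
  have hxR : ‖x‖ ≤ R' := (hR x hx).trans (le_max_left _ _)
  set D := max (Metric.infDist x K) (Metric.infDist x (perp z))
  have hD0 : 0 ≤ D := Metric.infDist_nonneg.trans (le_max_left _ _)
  have hDR : D ≤ R' := by
    refine max_le ?_ ?_
    · exact (Metric.infDist_le_dist_of_mem h0).trans (by simpa using hxR)
    · exact (Metric.infDist_le_dist_of_mem h0p).trans (by simpa using hxR)
  have hperp : (inner ℝ x z : ℝ) ≤ ‖z‖ * D := by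
    rcases eq_or_ne z 0 with rfl | hz0
    · simp
    have hzn : 0 < ‖z‖ := norm_pos_iff.2 hz0
    have : (inner ℝ x z : ℝ) / ‖z‖ ≤ Metric.infDist x (perp z) := by
      refine (Metric.le_infDist ⟨0, h0p⟩).2 fun v hv => ?_
      rw [div_le_iff₀ hzn, dist_eq_norm]
      have hv : (inner ℝ v z : ℝ) = 0 := hv
      have := real_inner_le_norm (x - v) z
      rwa [inner_sub_left, hv, sub_zero] at this
    rw [div_le_iff₀ hzn] at this
    nlinarith [le_max_right (Metric.infDist x K) (Metric.infDist x (perp z))]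
  -- The slack `δ` replaces an attained nearest point. As `D ≤ R'`, the approximating `k` has norm
  -- at most `2 * R' + 1`.
  have key : ∀ δ ∈ Ioo (0 : ℝ) 1, Metric.infDist x (K ∩ perp z) ≤
      (D + δ) + C * √(‖z‖ * (2 * D + δ)) := by
    intro δ hδ
    obtain ⟨k, hk, hxk⟩ := (Metric.infDist_lt_iff ⟨0, h0⟩).1
      (show Metric.infDist x K < D + δ by
        linarith [le_max_left (Metric.infDist x K) (Metric.infDist x (perp z)), hδ.1])
    have hxk' : ‖k - x‖ < D + δ := by rwa [← dist_eq_norm, dist_comm]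
    have hkn : ‖k‖ ≤ 2 * R' + 1 := by
      have := norm_add_le (k - x) x
      rw [sub_add_cancel] at this
      linarith [hδ.2]
    have hin : (inner ℝ k z : ℝ) ≤ ‖z‖ * (2 * D + δ) := by
      have h1 := real_inner_le_norm (k - x) z
      rw [inner_sub_left] at h1
      have h2 : ‖k - x‖ * ‖z‖ ≤ (D + δ) * ‖z‖ :=
        mul_le_mul_of_nonneg_right hxk'.le (norm_nonneg z)
      linarith
    have h3 := hCK k hk hkn
    have h4 := Metric.infDist_le_infDist_add_dist (s := K ∩ perp z) (x := x) (y := k)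
    have h5 : C * √(inner ℝ k z) ≤ C * √(‖z‖ * (2 * D + δ)) := by gcongr
    linarith
  have hlim : Metric.infDist x (K ∩ perp z) ≤ (D + 0) + C * √(‖z‖ * (2 * D + 0)) := by
    have hcont : Continuous fun δ : ℝ => (D + δ) + C * √(‖z‖ * (2 * D + δ)) := by fun_prop
    refine ge_of_tendsto ((hcont.tendsto 0).mono_left (nhdsWithin_le_nhds (s := Ioi 0))) ?_
    filter_upwards [Ioo_mem_nhdsGT (zero_lt_one' ℝ)] with δ hδ using key δ hδ
  rw [← Real.sqrt_eq_rpow]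
  have e1 : √(‖z‖ * (2 * D + 0)) = √(2 * ‖z‖) * √D := by
    rw [← Real.sqrt_mul (by positivity)]; ring_nf
  have e2 : D ≤ √R' * √D := by
    calc D = √D * √D := (Real.mul_self_sqrt hD0).symm
      _ ≤ √R' * √D := by gcongr
  rw [e1] at hlim
  nlinarith [Real.sqrt_nonneg D]

/-- Turns a Lipschitzian bound into a square-root bound on a bounded range. -/
theorem le_mul_sqrt_of_le_mul {x a b M : ℝ} (hx : 0 ≤ x) (hM : x ≤ M) (ha : 0 ≤ a)
    (hb : b ≤ a * x) : b ≤ a * √M * √x := by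
  calc b ≤ a * x := hb
    _ = a * (√x * √x) := by rw [Real.mul_self_sqrt hx]
    _ ≤ a * (√M * √x) := by gcongr
    _ = _ := by ring

variable {f : ℝ → EReal} {y : ℝ}

theorem tangent_mem_dualCone (hf : StandingAssumption f) (hy : y ∈ effDom f) {p : ℝ}
    (hp : p ∈ interior (effDom f)) {k : E3} (hk : k ∈ perspectiveCone f y) :
    0 ≤ -deriv (realValue f) p * k 0 + (deriv (realValue f) p * p - realValue f p) * k 1
      + k 2 := by
  have := minorant_le hf hy (a := deriv (realValue f) p)
    (b := realValue f p - deriv (realValue f) p * p)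
    (fun w hw => by linarith [tangent_le hf hp hw]) hk
  linarith

/-- The cone is pointed: the dual cone has an element positive at a given nonzero recession
vector. -/
theorem exists_dual_pos (hf : StandingAssumption f) (hy : y ∈ effDom f) {v : E3}
    (hv : v ∈ perspectiveCone f y) (hv0 : v ≠ 0) (hv1 : v 1 = 0) :
    ∃ g0 g1 g2 : ℝ, (∀ k ∈ perspectiveCone f y, 0 ≤ g0 * k 0 + g1 * k 1 + g2 * k 2) ∧
      0 < g0 * v 0 + g2 * v 2 := by
  rcases (height_nonneg hf hy hv).eq_or_lt with h2 | h2
  · obtain ⟨p, hp, hpd⟩ := exists_deriv_ne_zero hf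
    refine ⟨-deriv (realValue f) p, deriv (realValue f) p * p - realValue f p, 1,
      fun k hk => by linarith [tangent_mem_dualCone hf hy hp hk], ?_⟩
    have h := tangent_mem_dualCone hf hy hp hv
    rw [hv1, ← h2, mul_zero, add_zero, add_zero] at h
    rw [← h2, mul_zero, add_zero]
    refine h.lt_of_ne fun e => ?_
    have hv00 : v 0 = 0 := by simpa [hpd] using e.symm
    apply hv0
    ext i
    fin_cases i
    · exact hv00
    · exact hv1
    · exact h2.symm
  · exact ⟨0, 0, 1, fun k hk => by simpa using height_nonneg hf hy hk, by simpa using h2⟩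

/-- Lipschitzian face bound at a normal that remains in the dual cone when its scale coordinate
is decreased. -/
theorem face_bound_of_recession (hf : StandingAssumption f) (hy : y ∈ effDom f) {z v : E3}
    (hv : v ∈ perspectiveCone f y) (hv0 : v ≠ 0) (hv1 : v 1 = 0) (hvz : inner ℝ v z = 0)
    (hz02 : z 0 ≠ 0 ∨ z 2 ≠ 0) {δ : ℝ} (hδ : 0 < δ)
    (hδz : ∀ k ∈ perspectiveCone f y, δ * k 1 ≤ inner ℝ k z) (R : ℝ) :
    ∃ C : ℝ, 0 ≤ C ∧ ∀ k ∈ perspectiveCone f y, ‖k‖ ≤ R →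
      Metric.infDist k (perspectiveCone f y ∩ perp z) ≤ C * √(inner ℝ k z) := by
  obtain ⟨g0, g1, g2, hg, hgv⟩ := exists_dual_pos hf hy hv hv0 hv1
  rw [inner_eq_coords, hv1] at hvz
  have hN : 0 < v 0 ^ 2 + v 2 ^ 2 := by
    have hne : v 0 ≠ 0 ∨ v 2 ≠ 0 := by
      by_contra! h
      apply hv0
      ext i
      fin_cases i
      · exact h.1
      · exact hv1
      · exact h.2
    rcases hne with h | h
    · have := pow_pos (abs_pos.2 h) 2
      rw [sq_abs] at this
      nlinarith [sq_nonneg (v 2)]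
    · have := pow_pos (abs_pos.2 h) 2
      rw [sq_abs] at this
      nlinarith [sq_nonneg (v 0)]
  set N := v 0 ^ 2 + v 2 ^ 2
  set G := v 0 * z 2 - v 2 * z 0
  -- In the `(0, 2)` plane `z` is nonzero and orthogonal to `v`, so it cannot also be parallel to
  -- `v`.
  have hG : G ≠ 0 := by
    intro h
    have e0 : N * z 0 = 0 := by simp only [N]; simp only [G] at h; linear_combination v 0 * hvz - v 2 * h
    have e2 : N * z 2 = 0 := by simp only [N]; simp only [G] at h; linear_combination v 2 * hvz + v 0 * h
    rcases hz02 with h | h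
    · exact h (by simpa [hN.ne'] using e0)
    · exact h (by simpa [hN.ne'] using e2)
  have hGa : 0 < |G| := abs_pos.2 hG
  set n : E3 := !₂[-v 2, 0, v 0]
  set e : E3 := !₂[0, 1, 0]
  set A := (1 + |z 1| / δ) / |G|
  set A2 := (A * |g2 * v 0 - g0 * v 2| + |g1| / δ) / (g0 * v 0 + g2 * v 2)
  set L := A2 * ‖v‖ + A * ‖n‖ + 1 / δ * ‖e‖
  have hA : 0 ≤ A := by positivity
  have hA2 : 0 ≤ A2 := by positivity
  have hL : 0 ≤ L := by positivity
  refine ⟨L * √(R * ‖z‖), by positivity, fun k hk hkR => ?_⟩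
  have hk1 := nonneg_of_mem_cone hk
  set ε : ℝ := inner ℝ k z
  have hε1 : δ * k 1 ≤ ε := hδz k hk
  have hε : 0 ≤ ε := (mul_nonneg hδ.le hk1).trans hε1
  have hεR : ε ≤ R * ‖z‖ :=
    (real_inner_le_norm k z).trans (mul_le_mul_of_nonneg_right hkR (norm_nonneg z))
  refine le_mul_sqrt_of_le_mul hε hεR hL ?_
  have hk1' : k 1 ≤ 1 / δ * ε := by
    rw [one_div_mul_eq_div, le_div_iff₀ hδ]; linarith
  have hεe : ε = k 0 * z 0 + k 1 * z 1 + k 2 * z 2 := inner_eq_coords k z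
  -- Coordinates of `k` in the orthogonal basis `v`, `n`, `e`. Both `k 1` and `β` are of order `ε`;
  -- the dual functional `g` shows that `α` can be negative only to that order, so `max α 0` gives a
  -- close point of the face.
  set α := (k 0 * v 0 + k 2 * v 2) / N
  set β := (k 2 * v 0 - k 0 * v 2) / N
  have k0 : k 0 = α * v 0 - β * v 2 := by
    simp only [α, β]; field_simp; simp only [N]; ring
  have k2 : k 2 = α * v 2 + β * v 0 := by
    simp only [α, β]; field_simp; simp only [N]; ring
  have hβ : |β| ≤ A * ε := by
    have e1 : β * G = ε - k 1 * z 1 := by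
      rw [hεe, k0, k2]; simp only [G]; linear_combination -α * hvz
    have e2 : |β| * |G| ≤ (1 + |z 1| / δ) * ε := by
      rw [← abs_mul, e1]
      calc |ε - k 1 * z 1| ≤ |ε| + |k 1 * z 1| := abs_sub _ _
        _ = ε + k 1 * |z 1| := by rw [abs_of_nonneg hε, abs_mul, abs_of_nonneg hk1]
        _ ≤ ε + (1 / δ * ε) * |z 1| := by gcongr
        _ = _ := by ring
    rw [← le_div_iff₀ hGa] at e2
    exact e2.trans_eq (by simp only [A]; ring)
  have hα : -(A2 * ε) ≤ α := by
    have h1 := hg k hk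
    rw [k0, k2] at h1
    have h2 : |β * (g2 * v 0 - g0 * v 2)| ≤ (A * ε) * |g2 * v 0 - g0 * v 2| := by
      rw [abs_mul]; gcongr
    have h3 : |g1 * k 1| ≤ |g1| * (1 / δ * ε) := by
      rw [abs_mul, abs_of_nonneg hk1]; gcongr
    have h4 : -((A * |g2 * v 0 - g0 * v 2| + |g1| / δ) * ε) ≤ α * (g0 * v 0 + g2 * v 2) := by
      have e4 : |g1| * (1 / δ * ε) = |g1| / δ * ε := by ring
      have := le_abs_self (β * (g2 * v 0 - g0 * v 2))
      have := le_abs_self (g1 * k 1)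
      linarith
    rw [← div_le_iff₀ hgv] at h4
    refine le_trans (le_of_eq ?_) h4
    simp only [A2]; ring
  set α' := max α 0
  have hface : α' • v ∈ perspectiveCone f y ∩ perp z := by
    refine ⟨smul_mem_cone hf hy hv (le_max_right _ _), ?_⟩
    change (inner ℝ (α' • v) z : ℝ) = 0
    rw [inner_smul_left, inner_eq_coords, hv1, hvz, mul_zero]
  have hαα : |α - α'| ≤ A2 * ε := by
    have : 0 ≤ A2 * ε := by positivity
    rcases max_cases α 0 with ⟨h, _⟩ | ⟨h, h'⟩
    · simp only [α', h]; simpa using this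
    · simp only [α', h, sub_zero]; rw [abs_of_neg h']; linarith
  have hdec : k - α' • v = (α - α') • v + β • n + k 1 • e := by
    ext i
    fin_cases i
    · simp [n, e, k0]; ring
    · simp [n, e, hv1]
    · simp [n, e, k2]; ring
  calc Metric.infDist k (perspectiveCone f y ∩ perp z) ≤ dist k (α' • v) :=
        Metric.infDist_le_dist_of_mem hface
    _ = ‖(α - α') • v + β • n + k 1 • e‖ := by rw [dist_eq_norm, hdec]
    _ ≤ ‖(α - α') • v‖ + ‖β • n‖ + ‖k 1 • e‖ := norm_add₃_le
    _ = |α - α'| * ‖v‖ + |β| * ‖n‖ + k 1 * ‖e‖ := by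
        simp only [norm_smul, Real.norm_eq_abs, abs_of_nonneg hk1]
    _ ≤ (A2 * ε) * ‖v‖ + (A * ε) * ‖n‖ + (1 / δ * ε) * ‖e‖ := by gcongr
    _ = L * ε := by ring

/-- Square-root face bound at a normal exposing the ray over a point where `f` grows
quadratically. -/
theorem face_bound_of_quadratic_growth (hf : StandingAssumption f) (hy : y ∈ effDom f) {z : E3}
    {u m : ℝ} (hu : u ∈ effDom f) (hz : z ∈ dualCone (perspectiveCone f y)) (hz2 : 0 < z 2)
    (hgu : z 0 * u + z 1 + z 2 * realValue f u = 0) (hm : 0 < m)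
    (hgrow : ∀ w ∈ effDom f, ∀ l : ℝ, |l| ≤ 1 / 2 →
      m * (2 * l * (w - u) - l ^ 2) ≤ z 0 * w + z 1 + z 2 * realValue f w) (R : ℝ) :
    ∃ C : ℝ, 0 ≤ C ∧ ∀ k ∈ perspectiveCone f y, ‖k‖ ≤ R →
      Metric.infDist k (perspectiveCone f y ∩ perp z) ≤ C * √(inner ℝ k z) := by
  have hhom : ∀ k ∈ perspectiveCone f y, ∀ l : ℝ, |l| ≤ 1 / 2 →
      m * (2 * l * (k 0 - u * k 1) - l ^ 2 * k 1) ≤ inner ℝ k z := by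
    intro k hk l hl
    have := minorant_le hf hy (a := (2 * m * l - z 0) / z 2)
      (b := (-(2 * m * l * u) - m * l ^ 2 - z 1) / z 2) (fun w hw => by
        rw [div_mul_eq_mul_div, ← add_div, div_le_iff₀ hz2]
        linarith [hgrow w hw l hl]) hk
    rw [div_mul_eq_mul_div, div_mul_eq_mul_div, ← add_div, div_le_iff₀ hz2] at this
    rw [inner_eq_coords]
    linarith
  -- Large enough that `l = X / M` is admissible in `hhom` and that `k 1 ≤ M`.
  set M := 2 * ((1 + |u|) * |R|) + 1
  have hM : 0 < M := by positivity
  set S := √(M / m)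
  set e0 : E3 := !₂[1, 0, 0]
  set e2 : E3 := !₂[0, 0, 1]
  set C := S * ‖e0‖ + (√(R * ‖z‖) + |z 0| * S) / z 2 * ‖e2‖
  refine ⟨C, by positivity, fun k hk hkR => ?_⟩
  have hk1 := nonneg_of_mem_cone hk
  set ε : ℝ := inner ℝ k z
  have hε : 0 ≤ ε := hz k hk
  have hεR : ε ≤ R * ‖z‖ :=
    (real_inner_le_norm k z).trans (mul_le_mul_of_nonneg_right hkR (norm_nonneg z))
  have hεs : ε ≤ √(R * ‖z‖) * √ε := by
    simpa using le_mul_sqrt_of_le_mul hε hεR zero_le_one (b := ε) (by simp)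
  have c0 : |k 0| ≤ |R| := (PiLp.norm_apply_le k 0).trans (hkR.trans (le_abs_self R))
  have c1 : |k 1| ≤ |R| := (PiLp.norm_apply_le k 1).trans (hkR.trans (le_abs_self R))
  set X := k 0 - u * k 1
  have hX : |X| ≤ (1 + |u|) * |R| := by
    calc |X| ≤ |k 0| + |u * k 1| := abs_sub _ _
      _ ≤ |R| + |u| * |R| := by rw [abs_mul]; gcongr
      _ = _ := by ring
  have hXM : 2 * |X| ≤ M := by simp only [M]; linarith
  have hkM : k 1 ≤ M := by
    have h1 := le_abs_self (k 1)
    have h2 : 0 ≤ |u| * |R| := by positivity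
    have h3 := abs_nonneg R
    simp only [M]; nlinarith
  have hsq : X ^ 2 ≤ M / m * ε := by
    have h := hhom k hk (X / M) (by
      rw [abs_div, abs_of_pos hM, div_le_div_iff₀ hM (by norm_num)]; linarith)
    have h1 : X ^ 2 / M ≤ 2 * (X / M) * X - (X / M) ^ 2 * k 1 := by
      have : (X / M) ^ 2 * k 1 ≤ (X / M) ^ 2 * M := by gcongr
      have e : (X / M) ^ 2 * M = X ^ 2 / M := by field_simp
      have e' : 2 * (X / M) * X = 2 * (X ^ 2 / M) := by ring
      linarith
    have h2 : m * (X ^ 2 / M) ≤ ε := (mul_le_mul_of_nonneg_left h1 hm.le).trans h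
    rw [div_mul_eq_mul_div, le_div_iff₀ hm]
    rw [mul_div_assoc', div_le_iff₀ hM] at h2
    linarith
  have hXs : |X| ≤ S * √ε := by
    rw [← Real.sqrt_sq_eq_abs, ← Real.sqrt_mul (by positivity)]
    exact Real.sqrt_le_sqrt hsq
  set v : E3 := !₂[u, 1, realValue f u]
  have hface : k 1 • v ∈ perspectiveCone f y ∩ perp z := by
    refine ⟨smul_mem_cone hf hy (graph_mem_cone hf hu) hk1, ?_⟩
    change (inner ℝ (k 1 • v) z : ℝ) = 0
    rw [inner_smul_left, inner_eq_coords]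
    have : v 0 * z 0 + v 1 * z 1 + v 2 * z 2 = 0 := by simp [v]; linarith
    rw [this, mul_zero]
  -- The scales cancel, and since `⟨v, z⟩ = 0` the height error is determined by `ε` and `X`.
  have hdec : k - k 1 • v = X • e0 + ((ε - z 0 * X) / z 2) • e2 := by
    have hεe : ε = k 0 * z 0 + k 1 * z 1 + k 2 * z 2 := inner_eq_coords k z
    ext i
    fin_cases i
    · simp [v, e0, e2, X]; ring
    · simp [v, e0, e2]
    · simp [v, e0, e2]
      field_simp
      rw [hεe]
      simp only [X]
      linear_combination -(k 1) * hgu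
  have hc2 : |(ε - z 0 * X) / z 2| ≤ (√(R * ‖z‖) + |z 0| * S) / z 2 * √ε := by
    rw [abs_div, abs_of_pos hz2, div_mul_eq_mul_div]
    gcongr
    calc |ε - z 0 * X| ≤ |ε| + |z 0 * X| := abs_sub _ _
      _ = ε + |z 0| * |X| := by rw [abs_of_nonneg hε, abs_mul]
      _ ≤ √(R * ‖z‖) * √ε + |z 0| * (S * √ε) := by gcongr
      _ = _ := by ring
  calc Metric.infDist k (perspectiveCone f y ∩ perp z) ≤ dist k (k 1 • v) :=
        Metric.infDist_le_dist_of_mem hface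
    _ = ‖X • e0 + ((ε - z 0 * X) / z 2) • e2‖ := by rw [dist_eq_norm, hdec]
    _ ≤ ‖X • e0‖ + ‖((ε - z 0 * X) / z 2) • e2‖ := norm_add_le _ _
    _ = |X| * ‖e0‖ + |(ε - z 0 * X) / z 2| * ‖e2‖ := by
        simp only [norm_smul, Real.norm_eq_abs]
    _ ≤ (S * √ε) * ‖e0‖ + ((√(R * ‖z‖) + |z 0| * S) / z 2 * √ε) * ‖e2‖ := by gcongr
    _ = C * √ε := by ring

end ErrorBound

/-! ### The exceptional normals form a null set -/

section Exceptional

theorem hausdorffMeasure_line {s : ℝ} (hs : 1 < s) (w : E3) :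
    Measure.hausdorffMeasure s (range fun t : ℝ => t • w) = 0 := by
  have h : dimH (range fun t : ℝ => t • w) ≤ 1 := by
    have := ContDiff.dimH_range_le (f := fun t : ℝ => t • w) (by fun_prop)
    simpa using this
  lift s to NNReal using by linarith
  refine hausdorffMeasure_of_dimH_lt (h.trans_lt ?_)
  exact_mod_cast hs

/-- A set of vectors contained in a line through the origin. -/
def IsThin (S : Set E3) : Prop := ∃ w : E3, S ⊆ range fun t : ℝ => t • w

theorem isThin_of_parallel {S : Set E3}
    (h : ∀ z ∈ S, ∀ z' ∈ S, ∃ a b : ℝ, a ≠ 0 ∧ a • z = b • z') : IsThin S := by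
  rcases S.eq_empty_or_nonempty with rfl | ⟨w, hw⟩
  · exact ⟨0, empty_subset _⟩
  · refine ⟨w, fun z hz => ?_⟩
    obtain ⟨a, b, ha, hab⟩ := h z hz w hw
    refine ⟨a⁻¹ * b, ?_⟩
    change (a⁻¹ * b) • w = z
    rw [mul_smul, ← hab, smul_smul, inv_mul_cancel₀ ha, one_smul]

theorem IsThin.measure_eq_zero {S : Set E3} (hS : IsThin S) {s : ℝ} (hs : 1 < s) :
    Measure.hausdorffMeasure s {z | z ∈ S ∨ -z ∈ S} = 0 := by
  obtain ⟨w, hw⟩ := hS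
  refine measure_mono_null ?_ (hausdorffMeasure_line hs w)
  rintro z (h | h)
  · exact hw h
  · obtain ⟨t, ht⟩ := hw h
    exact ⟨-t, by simp only at ht ⊢; rw [neg_smul, ht, neg_neg]⟩

variable {f : ℝ → EReal} {y : ℝ}

/-- The elements of the dual cone leaving it as soon as the scale coordinate decreases. -/
def lowerBoundary (K : Set E3) : Set E3 :=
  {z ∈ dualCone K | ∀ δ : ℝ, 0 < δ → ¬ ∀ k ∈ K, δ * k 1 ≤ inner ℝ k z}

/-- A smaller scale coordinate on the side of `z` would supply an admissible decrease `δ` for `z'`.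
Hence a lower boundary vector is determined up to positive scaling by the direction of its
coordinates `0` and `2`. -/
theorem scale_le_of_mem_lowerBoundary {K : Set E3} {z z' : E3} (hz : z ∈ dualCone K)
    (hz' : z' ∈ lowerBoundary K) {a b : ℝ} (ha : 0 < a) (hb : 0 < b) (h0 : a * z 0 = b * z' 0)
    (h2 : a * z 2 = b * z' 2) : b * z' 1 ≤ a * z 1 := by
  by_contra! hlt
  refine hz'.2 ((b * z' 1 - a * z 1) / b) (div_pos (by linarith) hb) fun k hk => ?_
  have h := mul_nonneg ha.le (hz k hk)
  rw [inner_eq_coords] at h ⊢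
  rw [div_mul_eq_mul_div, div_le_iff₀ hb]
  linear_combination h + k 0 * h0 + k 2 * h2

theorem smul_eq_of_mem_lowerBoundary {K : Set E3} {z z' : E3} (hz : z ∈ lowerBoundary K)
    (hz' : z' ∈ lowerBoundary K) {a b : ℝ} (ha : 0 < a) (hb : 0 < b) (h0 : a * z 0 = b * z' 0)
    (h2 : a * z 2 = b * z' 2) : a • z = b • z' := by
  ext i
  fin_cases i
  · simpa using h0
  · simpa using le_antisymm
      (scale_le_of_mem_lowerBoundary hz'.1 hz hb ha h0.symm h2.symm)
      (scale_le_of_mem_lowerBoundary hz.1 hz' ha hb h0 h2)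
  · simpa using h2

theorem isThin_scaleAxis : IsThin {z : E3 | z 0 = 0 ∧ z 2 = 0} := by
  refine ⟨!₂[0, 1, 0], fun z hz => ⟨z 1, ?_⟩⟩
  ext i
  fin_cases i
  · simpa using hz.1.symm
  · simp
  · simpa using hz.2.symm

theorem isThin_vertical {K : Set E3} (σ : ℝ) :
    IsThin {z | z ∈ lowerBoundary K ∧ z 2 = 0 ∧ 0 < σ * z 0} := by
  refine isThin_of_parallel fun z hz z' hz' => ⟨σ * z' 0, σ * z 0, hz'.2.2.ne', ?_⟩
  exact smul_eq_of_mem_lowerBoundary hz.1 hz'.1 hz'.2.2 hz.2.2 (by ring)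
    (by rw [hz.2.1, hz'.2.1]; ring)

/-- Vanishing on `v` makes `σ * z 0 / z 2` minimal among dual vectors of positive height. Two such
minimizers share this ratio, and the lower boundary then fixes the scale coordinate. -/
theorem isThin_recession {K : Set E3} (σ : ℝ) :
    IsThin {z | z ∈ lowerBoundary K ∧ 0 < z 2 ∧
      ∃ v ∈ K, v 1 = 0 ∧ 0 < σ * v 0 ∧ inner ℝ v z = 0} := by
  have key : ∀ z : E3, 0 < z 2 → ∀ v : E3, v 1 = 0 → 0 < σ * v 0 → inner ℝ v z = 0 →
      v ∈ K → ∀ z' ∈ dualCone K, 0 < z' 2 → 0 ≤ σ * (z' 0 * z 2 - z 0 * z' 2) := by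
    intro z hz2 v hv1 hv0 hvz hv z' hz' hz2'
    have h := hz' v hv
    rw [inner_eq_coords, hv1] at h hvz
    have h1 : 0 ≤ v 0 * (z' 0 * z 2 - z 0 * z' 2) := by
      have := mul_nonneg h hz2.le
      linear_combination this + z' 2 * hvz
    have h2 : 0 ≤ (σ * v 0) * (σ * (z' 0 * z 2 - z 0 * z' 2)) := by
      have := mul_nonneg (sq_nonneg σ) h1
      linarith
    exact nonneg_of_mul_nonneg_right h2 hv0
  refine isThin_of_parallel fun z hz z' hz' => ⟨z' 2, z 2, hz'.2.1.ne', ?_⟩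
  obtain ⟨hz, hz2, v, hv, hv1, hv0, hvz⟩ := hz
  obtain ⟨hz', hz2', v', hv', hv1', hv0', hvz'⟩ := hz'
  have h1 := key z hz2 v hv1 hv0 hvz hv z' hz'.1 hz2'
  have h2 := key z' hz2' v' hv1' hv0' hvz' hv' z hz.1 hz2
  have hσ : σ ≠ 0 := by rintro rfl; simp at hv0
  refine smul_eq_of_mem_lowerBoundary hz hz' hz2' hz2 ?_ (mul_comm _ _)
  have h3 : σ * (z' 0 * z 2 - z 0 * z' 2) = 0 := le_antisymm (by linarith) h1
  have := (mul_eq_zero.1 h3).resolve_left hσ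
  linarith

theorem dual_le_realValue (hf : StandingAssumption f) {z : E3}
    (hz : z ∈ dualCone (perspectiveCone f y)) {w : ℝ} (hw : w ∈ effDom f) :
    0 ≤ z 0 * w + z 1 + z 2 * realValue f w := by
  have := hz _ (graph_mem_cone hf hw)
  rw [inner_eq_coords] at this
  simp at this
  linarith

theorem touching_of_dual (hf : StandingAssumption f) {z : E3} {u : ℝ}
    (hz : z ∈ dualCone (perspectiveCone f y)) (hz2 : 0 < z 2)
    (hgu : z 0 * u + z 1 + z 2 * realValue f u = 0) :
    ∀ w ∈ effDom f, realValue f u + (-z 0 / z 2) * (w - u) ≤ realValue f w := by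
  intro w hw
  have h := dual_le_realValue hf hz hw
  have e : (-z 0 / z 2) * (w - u) = -z 0 * (w - u) / z 2 := by ring
  rw [e, ← le_sub_iff_add_le', div_le_iff₀ hz2]
  linarith

/-- Differentiability at `u` forces the slope `-z 0 / z 2` to be the derivative, and touching at `u`
then fixes `z 1`. -/
theorem isThin_tangent (hf : StandingAssumption f) {u : ℝ} (hu : u ∈ interior (effDom f)) :
    IsThin {z | z ∈ dualCone (perspectiveCone f y) ∧ 0 < z 2 ∧
      z 0 * u + z 1 + z 2 * realValue f u = 0} := by
  refine isThin_of_parallel fun z hz z' hz' => ⟨z' 2, z 2, hz'.2.1.ne', ?_⟩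
  obtain ⟨hz, hz2, hzu⟩ := hz
  obtain ⟨hz', hz2', hzu'⟩ := hz'
  have h1 := slope_eq_deriv hf hu (touching_of_dual hf hz hz2 hzu)
  have h2 := slope_eq_deriv hf hu (touching_of_dual hf hz' hz2' hzu')
  rw [← h2, div_eq_div_iff hz2.ne' hz2'.ne'] at h1
  ext i
  fin_cases i
  · simp only [Fin.zero_eta, PiLp.smul_apply, smul_eq_mul]; linarith
  · simp only [Fin.mk_one, PiLp.smul_apply, smul_eq_mul]
    linear_combination z' 2 * hzu - z 2 * hzu' + u * h1
  · simp [mul_comm]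

theorem height_nonneg_of_mem_dualCone (hf : StandingAssumption f) (hy : y ∈ effDom f) {z : E3}
    (hz : z ∈ dualCone (perspectiveCone f y)) : 0 ≤ z 2 := by
  have := hz _ (axis_mem_cone hf hy)
  rw [inner_eq_coords] at this
  simpa using this

/-- The error bound at a dual vector exposing a nonzero recession direction. -/
theorem uniformHolder_of_recession (hf : StandingAssumption f) (hy : y ∈ effDom f) {z v : E3}
    (hz : z ∈ dualCone (perspectiveCone f y)) (hv : v ∈ perspectiveCone f y) (hv0 : v ≠ 0)
    (hv1 : v 1 = 0) (hvz : inner ℝ v z = 0) (hz02 : z 0 ≠ 0 ∨ z 2 ≠ 0)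
    (hzb : z ∉ lowerBoundary (perspectiveCone f y)) :
    UniformHolderErrorBound (perspectiveCone f y) (perp z) (1 / 2) := by
  have : ∃ δ : ℝ, 0 < δ ∧ ∀ k ∈ perspectiveCone f y, δ * k 1 ≤ inner ℝ k z := by
    by_contra! hcon
    refine hzb ⟨hz, fun δ hδ hall => ?_⟩
    obtain ⟨k, hk, hlt⟩ := hcon δ hδ
    exact absurd (hall k hk) (not_le.2 hlt)
  obtain ⟨δ, hδ, hδz⟩ := this
  exact uniformHolder_of_face_bound (zero_mem_cone hf hy) hz
    (face_bound_of_recession hf hy hv hv0 hv1 hvz hz02 hδ hδz)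

/-- The dual vectors at which the error bound is not claimed. -/
def exceptionalSet (K : Set E3) (F : ℝ → ℝ) (W : Set ℝ) : Set E3 :=
  {z | z 0 = 0 ∧ z 2 = 0} ∪ (⋃ σ ∈ ({1, -1} : Set ℝ),
    {z | z ∈ lowerBoundary K ∧ z 2 = 0 ∧ 0 < σ * z 0} ∪
    {z | z ∈ lowerBoundary K ∧ 0 < z 2 ∧
      ∃ v ∈ K, v 1 = 0 ∧ 0 < σ * v 0 ∧ inner ℝ v z = 0}) ∪
  ⋃ u ∈ W, {z | z ∈ dualCone K ∧ 0 < z 2 ∧ z 0 * u + z 1 + z 2 * F u = 0}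

theorem exists_sign {x : ℝ} (hx : x ≠ 0) : ∃ σ ∈ ({1, -1} : Set ℝ), 0 < σ * x := by
  rcases hx.lt_or_gt with h | h
  · exact ⟨-1, by simp, by linarith⟩
  · exact ⟨1, by simp, by linarith⟩

theorem uniformHolder_of_notMem_exceptionalSet (hf : StandingAssumption f) (hy : y ∈ effDom f)
    {W : Set ℝ} (hW : W.Finite)
    (hsc : ∀ C : Set ℝ, C ⊆ interior (effDom f) \ W → IsCompact C → Convex ℝ C →
      ∃ m : ℝ, 0 < m ∧ StrongConvexOn C m (realValue f)) {z v : E3}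
    (hz : z ∈ dualCone (perspectiveCone f y)) (hv : v ∈ perspectiveCone f y) (hv0 : v ≠ 0)
    (hvz : inner ℝ v z = 0)
    (hE : z ∉ exceptionalSet (perspectiveCone f y) (realValue f) W) :
    UniformHolderErrorBound (perspectiveCone f y) (perp z) (1 / 2) := by
  simp only [exceptionalSet, mem_union, mem_iUnion, not_or, not_exists, mem_ofPred_eq] at hE
  obtain ⟨⟨hE1, hE2⟩, hE3⟩ := hE
  rcases (height_nonneg_of_mem_dualCone hf hy hz).eq_or_lt with hz2 | hz2
  · have hz0 : z 0 ≠ 0 := fun h => hE1 ⟨h, hz2.symm⟩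
    obtain ⟨σ, hσ, hσz⟩ := exists_sign hz0
    -- As `z 2 = 0`, the vertical axis lies in the face and serves as recession vector in place of
    -- `v`.
    refine uniformHolder_of_recession hf hy hz (axis_mem_cone hf hy)
      (fun h => by simpa using congrArg (fun q : E3 => q 2) h) (by simp)
      (by rw [inner_eq_coords]; simp [← hz2]) (Or.inl hz0)
      (fun hb => (hE2 σ hσ).1 ⟨hb, hz2.symm, hσz⟩)
  rcases (nonneg_of_mem_cone hv).eq_or_lt with hv1 | hv1
  · have hvx : v 0 ≠ 0 := by
      intro h
      have h2 := hvz
      rw [inner_eq_coords, h, ← hv1, zero_mul, zero_mul, zero_add, zero_add] at h2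
      apply hv0
      ext i
      fin_cases i
      · exact h
      · exact hv1.symm
      · exact (mul_eq_zero.1 h2).resolve_right hz2.ne'
    obtain ⟨σ, hσ, hσv⟩ := exists_sign hvx
    exact uniformHolder_of_recession hf hy hz hv hv0 hv1.symm hvz (Or.inr hz2.ne')
      (fun hb => (hE2 σ hσ).2 ⟨hb, hz2, v, hv, hv1.symm, hσv, hvz⟩)
  · obtain ⟨hu, hle⟩ := (le_coe_iff hf).1 ((mem_cone_of_pos hv1).1 hv)
    set u := v 0 / v 1
    -- The point `v` lies on or above the graph ray over `u`, yet `z` vanishes on `v` and is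
    -- nonnegative on that ray.
    have hgu : z 0 * u + z 1 + z 2 * realValue f u = 0 := by
      refine le_antisymm ?_ (dual_le_realValue hf hz hu)
      have h1 := mul_le_mul_of_nonneg_left hle hz2.le
      have h2 : z 0 * u + z 1 + z 2 * (v 2 / v 1) = 0 := by
        rw [inner_eq_coords] at hvz
        simp only [u]
        field_simp
        linarith
      linarith
    have hui := mem_interior_of_touching hf hu (touching_of_dual hf hz hz2 hgu)
    have huW : u ∉ W := fun h => hE3 u h ⟨hz, hz2, hgu⟩
    obtain ⟨m, hm, hgrow⟩ := exists_quadratic_growth hf hW hsc hui huW hz2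
      (fun w hw => dual_le_realValue hf hz hw) hgu
    exact uniformHolder_of_face_bound (zero_mem_cone hf hy) hz
      (face_bound_of_quadratic_growth hf hy hu hz hz2 hgu hm hgrow)

theorem measure_exceptionalSet (hf : StandingAssumption f) {W : Set ℝ} (hW : W.Finite)
    (hWd : W ⊆ interior (effDom f)) {s : ℝ} (hs : 1 < s) :
    Measure.hausdorffMeasure s
      {z | z ∈ exceptionalSet (perspectiveCone f y) (realValue f) W ∨
        -z ∈ exceptionalSet (perspectiveCone f y) (realValue f) W} = 0 := by
  -- Symmetrized because only one of `z` and `-z` need be in the dual cone.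
  let sym (S : Set E3) : Set E3 := {z | z ∈ S ∨ -z ∈ S}
  have hU : ∀ S T : Set E3, Measure.hausdorffMeasure s (sym S) = 0 →
      Measure.hausdorffMeasure s (sym T) = 0 → Measure.hausdorffMeasure s (sym (S ∪ T)) = 0 := by
    intro S T hS hT
    refine measure_mono_null ?_ (measure_union_null hS hT)
    rintro z ((h | h) | (h | h))
    exacts [Or.inl (Or.inl h), Or.inr (Or.inl h), Or.inl (Or.inr h), Or.inr (Or.inr h)]
  have hB : ∀ (I : Set ℝ) (T : ℝ → Set E3), I.Finite →
      (∀ i ∈ I, Measure.hausdorffMeasure s (sym (T i)) = 0) →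
      Measure.hausdorffMeasure s (sym (⋃ i ∈ I, T i)) = 0 := by
    intro I T hI hT
    refine measure_mono_null ?_ ((measure_biUnion_null_iff hI.countable).2 hT)
    rintro z (h | h)
    · obtain ⟨i, hi, hz⟩ := mem_iUnion₂.1 h
      exact mem_iUnion₂.2 ⟨i, hi, Or.inl hz⟩
    · obtain ⟨i, hi, hz⟩ := mem_iUnion₂.1 h
      exact mem_iUnion₂.2 ⟨i, hi, Or.inr hz⟩
  refine hU _ _ (hU _ _ (isThin_scaleAxis.measure_eq_zero hs) (hB _ _ (toFinite _) fun σ _ =>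
    hU _ _ ((isThin_vertical σ).measure_eq_zero hs)
      ((isThin_recession σ).measure_eq_zero hs))) (hB _ _ hW fun u hu =>
    (isThin_tangent hf (hWd hu)).measure_eq_zero hs)

end Exceptional

end PerspectiveCone

theorem mainTheorem2 (f : ℝ → EReal) (hf : PerspectiveCone.StandingAssumption f)
    (y : ℝ) (hy : y ∈ PerspectiveCone.effDom f) (s : ℝ) (hs : 1 < s) :
    ∀ᵐ z ∂(Measure.hausdorffMeasure s : Measure PerspectiveCone.E3),
      z ∈ PerspectiveCone.upsilon (PerspectiveCone.perspectiveCone f y) →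
        PerspectiveCone.UniformHolderErrorBound
          (PerspectiveCone.perspectiveCone f y) (PerspectiveCone.perp z) (1 / 2) := by
  obtain ⟨W, hW, hWd, hsc, -⟩ := hf.exceptional
  filter_upwards [measure_eq_zero_iff_ae_notMem.1
    (PerspectiveCone.measure_exceptionalSet (y := y) hf hW hWd hs)] with z hzE hz
  rw [not_or] at hzE
  obtain ⟨hdual, v, hv, hv0, hvz⟩ := PerspectiveCone.exists_face_of_mem_upsilon hf hy hz
  rcases hdual with h | h
  · exact PerspectiveCone.uniformHolder_of_notMem_exceptionalSet hf hy hW hsc h hv hv0 hvz hzE.1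
  · rw [← PerspectiveCone.perp_neg]
    exact PerspectiveCone.uniformHolder_of_notMem_exceptionalSet hf hy hW hsc h hv hv0
      (by rw [inner_neg_right, hvz, neg_zero]) hzE.2
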